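/- Let $\Omega\subset\mathbb{R}^d$ be a bounded open set with $C^1$ boundary and outer unit normal $\nu$, and let $f\in C^1(\mathbb{R}^d;\mathbb{R}^d)$ be of the form $f(x)=Ax+\tilde f(x)$ with a matrix $A\in\mathbb{R}^{d\times d}$ and $\tilde f(x)=o(\|x\|)$ as $x\to 0$. Let $\Phi^t(z)$ denote the value at time $t\ge 0$ of the solution of $\dot x=f(x)$, $x(0)=z$. Assume that (i) $\operatorname{Re}\lambda<0$ for every eigenvalue $\lambda\in\mathbb{C}$ of $A$; (ii) $f$ satisfies the tangent condition $\nu(x)^\top f(x)\le 0$ for all $x\in\partial\Omega$; (iii) $v(z):=\int_0^\infty\|\Phi^t(z)\|^2\,dt<\infty$ for all $z\in\overline\Omega$, and $v^{1/2}\in W^{1,\infty}(\Omega)$. (By (ii), the solution starting in any $z\in\overline\Omega$ exists for all $t\ge 0$ and stays in $\overline\Omega$; this is part of the claim.) Let $w(x):=1/\|x\|$, and let $L^\infty_w(\Omega)$ be the space of measurable functions $\varphi$ on $\Omega$, modulo null sets, with $\|\varphi\|_{L^\infty_w(\Omega)}:=\operatorname{ess\,sup}_{x\in\Omega}|\varphi(x)w(x)|<\infty$.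 Then $S^*(t)\varphi:=\varphi\circ\Phi^t$, $t\ge 0$, defines a semigroup of bounded linear operators on $L^\infty_w(\Omega)$ which is exponentially stable: there are constants $M$ and $\omega>0$ such that $\|S^*(t)\|_{\mathcal{L}(L^\infty_w(\Omega))}\le M e^{-\omega t}$ for all $t\ge 0$. -/

import Mathlib

open MeasureTheory Set Filter Topology
open scoped NNReal ENNReal

noncomputable section

/-! ### Domains with `C¹` boundary and the tangent condition -/

/-- `ρ` is a local `C¹` defining function of the open set `Ω` at the point `p`: near `p` the set `Ω`
is `{ρ < 0}`, with `ρ p = 0` and `∇ρ(p) ≠ 0`. -/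
def IsLocalDefiningFunction {d : ℕ} (Ω : Set (EuclideanSpace ℝ (Fin d)))
    (p : EuclideanSpace ℝ (Fin d)) (ρ : EuclideanSpace ℝ (Fin d) → ℝ) : Prop :=
  ContDiff ℝ 1 ρ ∧ ρ p = 0 ∧ gradient ρ p ≠ 0 ∧ ∀ᶠ x in 𝓝 p, (x ∈ Ω ↔ ρ x < 0)

/-- `Ω` has a `C¹` boundary. -/
def HasC1Boundary {d : ℕ} (Ω : Set (EuclideanSpace ℝ (Fin d))) : Prop :=
  ∀ p ∈ frontier Ω, ∃ ρ : EuclideanSpace ℝ (Fin d) → ℝ, IsLocalDefiningFunction Ω p ρ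

/-- `n` is the outer unit normal of `Ω` at `p`: the normalized gradient of a local defining
function. -/
def IsOuterUnitNormal {d : ℕ} (Ω : Set (EuclideanSpace ℝ (Fin d)))
    (p n : EuclideanSpace ℝ (Fin d)) : Prop :=
  ∃ ρ : EuclideanSpace ℝ (Fin d) → ℝ, IsLocalDefiningFunction Ω p ρ ∧
    n = ‖gradient ρ p‖⁻¹ • gradient ρ p

/-- The tangent condition `ν(x)ᵀ f(x) ≤ 0` for all `x ∈ ∂Ω`. -/
def TangentCondition {d : ℕ} (Ω : Set (EuclideanSpace ℝ (Fin d)))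
    (f : EuclideanSpace ℝ (Fin d) → EuclideanSpace ℝ (Fin d)) : Prop :=
  ∀ x ∈ frontier Ω, ∀ n, IsOuterUnitNormal Ω x n → inner ℝ n (f x) ≤ 0

/-! ### The flow and the cost functional -/

/-- `x` solves `x' = f(x)` on `[0, ∞)` with `x(0) = z` (one-sided derivative at `t = 0`). -/
def IsForwardSolution {d : ℕ} (f : EuclideanSpace ℝ (Fin d) → EuclideanSpace ℝ (Fin d))
    (z : EuclideanSpace ℝ (Fin d)) (x : ℝ → EuclideanSpace ℝ (Fin d)) : Prop :=
  x 0 = z ∧ ∀ t, 0 ≤ t → HasDerivWithinAt x (f (x t)) (Ici 0) t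

open Classical in
/-- The flow `Φᵗ(z)`: the value at time `t` of the solution starting in `z`, where a solution on
`[0, ∞)` exists (it is then unique if `f` is `C¹`); the value is not meaningful otherwise. -/
def flow {d : ℕ} (f : EuclideanSpace ℝ (Fin d) → EuclideanSpace ℝ (Fin d)) (t : ℝ)
    (z : EuclideanSpace ℝ (Fin d)) : EuclideanSpace ℝ (Fin d) :=
  if h : ∃ x, IsForwardSolution f z x then h.choose t else z

/-- The cost functional `∫₀^∞ g(Φᵗ(z)) dt`, with values in `[0, ∞]`, for a nonnegative cost `g`. -/
def costFunctional {d : ℕ} (f : EuclideanSpace ℝ (Fin d) → EuclideanSpace ℝ (Fin d))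
    (g : EuclideanSpace ℝ (Fin d) → ℝ≥0) (z : EuclideanSpace ℝ (Fin d)) : ℝ≥0∞ :=
  ∫⁻ t in Ioi (0 : ℝ), (g (flow f t z) : ℝ≥0∞)

/-! ### The Sobolev space `W^{1,∞}` -/

/-- `g` is the weak `i`-th partial derivative of `u` on `Ω`. -/
def IsWeakPartialDeriv {d : ℕ} (Ω : Set (EuclideanSpace ℝ (Fin d))) (i : Fin d)
    (u g : EuclideanSpace ℝ (Fin d) → ℝ) : Prop :=
  ∀ φ : EuclideanSpace ℝ (Fin d) → ℝ, ContDiff ℝ (⊤ : ℕ∞) φ → HasCompactSupport φ → tsupport φ ⊆ Ω →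
    ∫ x in Ω, u x * fderiv ℝ φ x (EuclideanSpace.single i 1) = - ∫ x in Ω, g x * φ x

/-- `u ∈ W^{1,∞}(Ω)`. -/
def MemW1Infty {d : ℕ} (Ω : Set (EuclideanSpace ℝ (Fin d)))
    (u : EuclideanSpace ℝ (Fin d) → ℝ) : Prop :=
  MemLp u ∞ (volume.restrict Ω) ∧
    ∀ i : Fin d, ∃ g : EuclideanSpace ℝ (Fin d) → ℝ,
      MemLp g ∞ (volume.restrict Ω) ∧ IsWeakPartialDeriv Ω i u g

/-! ### The weighted space `L^∞_w(Ω)`, with norm `ess sup_{x ∈ Ω} |φ(x) w(x)|` -/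

/-- The classes of functions `φ` on `Ω`, modulo null sets, with `ess sup_Ω |φ w| < ∞`. -/
def weightedLinftySubmodule {d : ℕ} (Ω : Set (EuclideanSpace ℝ (Fin d)))
    (w : EuclideanSpace ℝ (Fin d) → ℝ) :
    Submodule ℝ (EuclideanSpace ℝ (Fin d) →ₘ[volume.restrict Ω] ℝ) where
  carrier := {φ | eLpNormEssSup (fun x => φ x * w x) (volume.restrict Ω) < ∞}
  zero_mem' := by
    have h : eLpNormEssSup (fun x => (0 : EuclideanSpace ℝ (Fin d) →ₘ[volume.restrict Ω] ℝ) x * w x)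
        (volume.restrict Ω) = eLpNormEssSup (fun _ => (0 : ℝ)) (volume.restrict Ω) := by
      apply eLpNormEssSup_congr_ae
      filter_upwards [AEEqFun.coeFn_zero (α := EuclideanSpace ℝ (Fin d)) (β := ℝ)
        (μ := volume.restrict Ω)] with x hx
      simp [hx]
    have h0 : eLpNormEssSup (fun _ : EuclideanSpace ℝ (Fin d) => (0 : ℝ)) (volume.restrict Ω) = 0 :=
      eLpNormEssSup_zero
    simp only [mem_ofPred_eq, h, h0]
    exact ENNReal.zero_lt_top
  add_mem' := by
    intro φ ψ hφ hψ
    have h : eLpNormEssSup (fun x => (φ + ψ) x * w x) (volume.restrict Ω) =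
        eLpNormEssSup ((fun x => φ x * w x) + fun x => ψ x * w x) (volume.restrict Ω) := by
      apply eLpNormEssSup_congr_ae
      filter_upwards [AEEqFun.coeFn_add φ ψ] with x hx
      simp [hx, add_mul]
    simp only [mem_ofPred_eq] at hφ hψ ⊢
    rw [h]
    exact eLpNormEssSup_add_le.trans_lt (ENNReal.add_lt_top.2 ⟨hφ, hψ⟩)
  smul_mem' := by
    intro c φ hφ
    have h : eLpNormEssSup (fun x => (c • φ) x * w x) (volume.restrict Ω) =
        eLpNormEssSup (c • fun x => φ x * w x) (volume.restrict Ω) := by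
      apply eLpNormEssSup_congr_ae
      filter_upwards [AEEqFun.coeFn_smul c φ] with x hx
      simp [hx, mul_assoc]
    simp only [mem_ofPred_eq] at hφ ⊢
    rw [h, eLpNormEssSup_const_smul]
    exact ENNReal.mul_lt_top enorm_lt_top hφ

/-- The weighted space `L^∞_w(Ω)`. -/
def WeightedLinfty {d : ℕ} (Ω : Set (EuclideanSpace ℝ (Fin d)))
    (w : EuclideanSpace ℝ (Fin d) → ℝ) : Type :=
  weightedLinftySubmodule Ω w

namespace WeightedLinfty

variable {d : ℕ} {Ω : Set (EuclideanSpace ℝ (Fin d))} {w : EuclideanSpace ℝ (Fin d) → ℝ}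

instance : AddCommGroup (WeightedLinfty Ω w) :=
  inferInstanceAs (AddCommGroup (weightedLinftySubmodule Ω w))

instance : Module ℝ (WeightedLinfty Ω w) :=
  inferInstanceAs (Module ℝ (weightedLinftySubmodule Ω w))

/-- A representative of the class `φ`. -/
def toFun (φ : WeightedLinfty Ω w) : EuclideanSpace ℝ (Fin d) → ℝ := φ.1

/-- The norm `ess sup_{x ∈ Ω} |φ(x) w(x)|`. -/
def weightedNorm (φ : WeightedLinfty Ω w) : ℝ :=
  (eLpNormEssSup (fun x => φ.toFun x * w x) (volume.restrict Ω)).toReal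

theorem toFun_add (φ ψ : WeightedLinfty Ω w) :
    (φ + ψ).toFun =ᵐ[volume.restrict Ω] φ.toFun + ψ.toFun :=
  AEEqFun.coeFn_add φ.1 ψ.1

theorem toFun_smul (c : ℝ) (φ : WeightedLinfty Ω w) :
    (c • φ).toFun =ᵐ[volume.restrict Ω] c • φ.toFun :=
  AEEqFun.coeFn_smul c φ.1

/-- The norm of `L^∞_w(Ω)` as a seminorm; it is definite if `w ≠ 0` almost everywhere, see
`norm_eq_zero_iff`. -/
def weightedSeminorm : Seminorm ℝ (WeightedLinfty Ω w) :=
  Seminorm.of weightedNorm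
    (by
      intro φ ψ
      have h : eLpNormEssSup (fun x => (φ + ψ).toFun x * w x) (volume.restrict Ω) =
          eLpNormEssSup ((fun x => φ.toFun x * w x) + fun x => ψ.toFun x * w x)
            (volume.restrict Ω) := by
        apply eLpNormEssSup_congr_ae
        filter_upwards [toFun_add φ ψ] with x hx
        simp [hx, add_mul]
      have h1 : eLpNormEssSup (fun x => φ.toFun x * w x) (volume.restrict Ω) ≠ ∞ := φ.2.ne
      have h2 : eLpNormEssSup (fun x => ψ.toFun x * w x) (volume.restrict Ω) ≠ ∞ := ψ.2.ne
      unfold weightedNorm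
      rw [h, ← ENNReal.toReal_add h1 h2]
      exact ENNReal.toReal_mono (ENNReal.add_ne_top.2 ⟨h1, h2⟩) eLpNormEssSup_add_le)
    (by
      intro c φ
      have h : eLpNormEssSup (fun x => (c • φ).toFun x * w x) (volume.restrict Ω) =
          eLpNormEssSup (c • fun x => φ.toFun x * w x) (volume.restrict Ω) := by
        apply eLpNormEssSup_congr_ae
        filter_upwards [toFun_smul c φ] with x hx
        simp [hx, mul_assoc]
      unfold weightedNorm
      rw [h, eLpNormEssSup_const_smul, ENNReal.toReal_mul, toReal_enorm])

instance : SeminormedAddCommGroup (WeightedLinfty Ω w) :=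
  weightedSeminorm.toAddGroupSeminorm.toSeminormedAddCommGroup

theorem norm_def (φ : WeightedLinfty Ω w) :
    ‖φ‖ = (eLpNormEssSup (fun x => φ.toFun x * w x) (volume.restrict Ω)).toReal := rfl

instance : NormedSpace ℝ (WeightedLinfty Ω w) where
  norm_smul_le c φ := (map_smul_eq_mul (weightedSeminorm (Ω := Ω) (w := w)) c φ).le

theorem norm_eq_zero_iff (hw : ∀ᵐ x ∂(volume.restrict Ω), w x ≠ 0) (φ : WeightedLinfty Ω w) :
    ‖φ‖ = 0 ↔ φ = 0 := by
  constructor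
  · intro h
    rw [norm_def, ENNReal.toReal_eq_zero_iff] at h
    have hφ : eLpNormEssSup (fun x => φ.toFun x * w x) (volume.restrict Ω) < ∞ := φ.2
    have h1 : eLpNormEssSup (fun x => φ.toFun x * w x) (volume.restrict Ω) = 0 :=
      h.resolve_right hφ.ne
    rw [eLpNormEssSup_eq_zero_iff] at h1
    apply Subtype.ext
    apply AEEqFun.ext
    filter_upwards [h1, hw, AEEqFun.coeFn_zero (α := EuclideanSpace ℝ (Fin d)) (β := ℝ)
      (μ := volume.restrict Ω)] with x hx hwx h0
    have h2 : φ.toFun x = 0 := (mul_eq_zero.1 hx).resolve_right hwx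
    exact h2.trans h0.symm
  · rintro rfl
    exact norm_zero

end WeightedLinfty

/-! ### The composition semigroup and exponential stability -/

/-- The family `S` of bounded operators on `L^∞_w(Ω)` is the semigroup `S(t) φ = φ ∘ Φᵗ`.
The formula is required for every representative `g` of `φ`, so that the composition is
well defined on classes. -/
structure IsCompositionSemigroup {d : ℕ} (Ω : Set (EuclideanSpace ℝ (Fin d)))
    (w : EuclideanSpace ℝ (Fin d) → ℝ)
    (Φ : ℝ → EuclideanSpace ℝ (Fin d) → EuclideanSpace ℝ (Fin d))
    (S : ℝ≥0 → WeightedLinfty Ω w →L[ℝ] WeightedLinfty Ω w) : Prop where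
  apply_eq : ∀ (t : ℝ≥0) (φ : WeightedLinfty Ω w) (g : EuclideanSpace ℝ (Fin d) → ℝ),
    g =ᵐ[volume.restrict Ω] φ.toFun →
      (S t φ).toFun =ᵐ[volume.restrict Ω] fun z => g (Φ t z)
  map_zero : S 0 = ContinuousLinearMap.id ℝ (WeightedLinfty Ω w)
  map_add : ∀ s t : ℝ≥0, S (s + t) = (S s).comp (S t)

/-- `‖S(t)‖ ≤ M e^{-ωt}` for all `t ≥ 0`, with constants `M` and `ω > 0`. -/
def IsExponentiallyStable {V : Type*} [SeminormedAddCommGroup V] [NormedSpace ℝ V]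
    (S : ℝ≥0 → V →L[ℝ] V) : Prop :=
  ∃ M ω : ℝ, 0 < ω ∧ ∀ t : ℝ≥0, ‖S t‖ ≤ M * Real.exp (-ω * t)

end

/-! Since the weight is `1 / ‖x‖`, the operator norm of composition with `Φᵗ` is at most `C` as soon
as `‖Φᵗ z‖ ≤ C ‖z‖` on `Ω`. Everything reduces to the pointwise bound `‖Φᵗ z‖ ≤ M e^{-ωt} ‖z‖` on
the closure of `Ω`.

Cutting `f` off outside a large ball gives a bounded, globally Lipschitz field `F` whose flow `Ψ`
exists for all times and consists of bi-Lipschitz homeomorphisms. The tangent condition and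
Grönwall's inequality for the squared distance to the closure of `Ω` show that this closure is
forward invariant (`IsGlobalFlow.mem_closure`), so `Ψ` and `Φ` agree there for `t ≥ 0`. Since `Ψᵗ`
is open and `Ω` is the interior of its closure, `Ω` is invariant too.

Near `0`, the spectral condition makes the linear flow a contraction after some time, and a
perturbation estimate transfers this to `Ψ` (`IsGlobalFlow.exists_norm_le_half`); iteration gives
exponential decay. Finite cost forces every orbit into this neighborhood, by compactness within a
uniform time, and before entry the norm grows by a bounded factor
(`IsGlobalFlow.exists_exponential_bound`). Composition respects null sets because `Ψ⁻ᵗ` is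
Lipschitz. -/

/-! ### Global flows of bounded Lipschitz fields -/

section LipschitzFlow

variable {E : Type*} [NormedAddCommGroup E] [NormedSpace ℝ E]

/-- A bounded, globally Lipschitz vector field has global solutions. -/
theorem exists_global_solution [CompleteSpace E] {F : E → E} {K C : ℝ≥0} (hF : LipschitzWith K F)
    (hC : ∀ x, ‖F x‖ ≤ C) (z : E) :
    ∃ γ : ℝ → E, γ 0 = z ∧ ∀ t, HasDerivAt γ (F (γ t)) t := by
  have hloc : ∀ n : ℕ, ∃ α : ℝ → E, α 0 = z ∧
      ∀ t ∈ Ioo (-((n : ℝ) + 1)) (n + 1), HasDerivAt α (F (α t)) t := by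
    intro n
    have h0 : (0 : ℝ) ∈ Icc (-((n : ℝ) + 1)) (n + 1) := ⟨by linarith [n.cast_nonneg (α := ℝ)], by positivity⟩
    -- At speed at most `C`, a solution stays within distance `C * (n + 1)` of `z` up to time `n +
    -- 1`, so the length of the interval is unrestricted.
    have hPL : IsPicardLindelof (fun _ => F) ⟨0, h0⟩ z (C * (n + 1)) 0 C K :=
      { lipschitzOnWith := fun _ _ => hF.lipschitzOnWith
        continuousOn := fun _ _ => continuousOn_const
        norm_le := fun _ _ x _ => hC x
        mul_max_le := by simp }
    obtain ⟨α, h1, h2⟩ := hPL.exists_eq_forall_mem_Icc_hasDerivWithinAt₀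
    exact ⟨α, h1, fun t ht => (h2 t (Ioo_subset_Icc_self ht)).hasDerivAt (Icc_mem_nhds ht.1 ht.2)⟩
  choose α hα0 hα using hloc
  have heq : ∀ n m : ℕ, n ≤ m → ∀ s ∈ Ioo (-((n : ℝ) + 1)) (n + 1), α n s = α m s := by
    intro n m hnm
    have hnm' : (n : ℝ) ≤ m := by exact_mod_cast hnm
    apply ODE_solution_unique_of_mem_Ioo (v := fun _ => F) (s := fun _ => univ) (K := K) (t₀ := 0)
      (fun _ _ => hF.lipschitzOnWith) ⟨by linarith [n.cast_nonneg (α := ℝ)], by positivity⟩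
      (fun t ht => ⟨hα n t ht, mem_univ _⟩)
      (fun t ht => ⟨hα m t ⟨by linarith [ht.1], by linarith [ht.2]⟩, mem_univ _⟩)
    rw [hα0, hα0]
  -- The local solutions are nested. Within distance one of `t` the index `⌈|s|⌉₊` is at most
  -- `⌈|t|⌉₊ + 1`, so there the glued curve is a single local solution.
  refine ⟨fun t => α ⌈|t|⌉₊ t, by simp [hα0], fun t => ?_⟩
  have habs : ∀ s : ℝ, s ∈ Ioo (-((⌈|s|⌉₊ : ℝ) + 1)) (⌈|s|⌉₊ + 1) := fun s => by
    have := Nat.le_ceil |s|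
    exact abs_lt.1 (by linarith)
  have hγ : ∀ s, |s| < |t| + 1 → α ⌈|s|⌉₊ s = α (⌈|t|⌉₊ + 1) s := by
    intro s hs
    apply heq _ _ _ s (habs s)
    rw [Nat.ceil_le]
    push_cast
    linarith [Nat.le_ceil |t|]
  have hnear : (fun s => α ⌈|s|⌉₊ s) =ᶠ[𝓝 t] α (⌈|t|⌉₊ + 1) := by
    have : ∀ᶠ s in 𝓝 t, |s| < |t| + 1 :=
      (continuous_abs.tendsto t).eventually (gt_mem_nhds (by linarith))
    exact this.mono hγ
  have hd := hα (⌈|t|⌉₊ + 1) t (by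
    have := habs t
    push_cast
    exact ⟨by linarith [this.1], by linarith [this.2]⟩)
  have hval := hγ t (by linarith)
  simp only [hval]
  exact hd.congr_of_eventuallyEq hnear

/-- `Ψ` is the global flow of the vector field `F`. -/
structure IsGlobalFlow (F : E → E) (Ψ : ℝ → E → E) : Prop where
  map_zero : ∀ z, Ψ 0 z = z
  hasDerivAt : ∀ z t, HasDerivAt (fun s => Ψ s z) (F (Ψ t z)) t

theorem exists_isGlobalFlow [CompleteSpace E] {F : E → E} {K C : ℝ≥0} (hF : LipschitzWith K F)
    (hC : ∀ x, ‖F x‖ ≤ C) : ∃ Ψ : ℝ → E → E, IsGlobalFlow F Ψ := by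
  choose γ h0 h1 using exists_global_solution hF hC
  exact ⟨fun t z => γ z t, h0, h1⟩

namespace IsGlobalFlow

variable {F : E → E} {Ψ : ℝ → E → E} {K : ℝ≥0}

theorem continuous_time (h : IsGlobalFlow F Ψ) (z : E) : Continuous fun t => Ψ t z :=
  continuous_iff_continuousAt.2 fun t => (h.hasDerivAt z t).continuousAt

theorem map_add (h : IsGlobalFlow F Ψ) (hF : LipschitzWith K F) (s t : ℝ) (z : E) :
    Ψ (s + t) z = Ψ s (Ψ t z) := by
  have := ODE_solution_unique_univ (v := fun _ => F) (s := fun _ => univ) (K := K) (t₀ := 0)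
    (f := fun s => Ψ (s + t) z) (g := fun s => Ψ s (Ψ t z))
    (fun _ => hF.lipschitzOnWith)
    (fun r => ⟨(h.hasDerivAt z (r + t)).comp_add_const r t, mem_univ _⟩)
    (fun r => ⟨h.hasDerivAt _ r, mem_univ _⟩) (by simp [h.map_zero])
  exact congrFun this s

theorem neg (h : IsGlobalFlow F Ψ) : IsGlobalFlow (fun x => -F x) fun t => Ψ (-t) where
  map_zero z := by simp [h.map_zero]
  hasDerivAt z t := by
    simpa [Function.comp_def] using (h.hasDerivAt z (-t)).scomp t (hasDerivAt_neg t)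

theorem dist_le_of_nonneg (h : IsGlobalFlow F Ψ) (hF : LipschitzWith K F) {t : ℝ} (ht : 0 ≤ t)
    (x y : E) : dist (Ψ t x) (Ψ t y) ≤ dist x y * Real.exp (K * t) := by
  have := dist_le_of_trajectories_ODE (v := fun _ => F) (K := K) (a := 0) (b := t)
    (f := fun s => Ψ s x) (g := fun s => Ψ s y) (δ := dist x y) (fun _ => hF)
    (h.continuous_time x).continuousOn (fun s _ => (h.hasDerivAt x s).hasDerivWithinAt)
    (h.continuous_time y).continuousOn (fun s _ => (h.hasDerivAt y s).hasDerivWithinAt)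
    (by simp [h.map_zero]) t ⟨ht, le_rfl⟩
  simpa using this

theorem dist_le (h : IsGlobalFlow F Ψ) (hF : LipschitzWith K F) (t : ℝ) (x y : E) :
    dist (Ψ t x) (Ψ t y) ≤ dist x y * Real.exp (K * |t|) := by
  rcases le_total 0 t with ht | ht
  · simpa [abs_of_nonneg ht] using h.dist_le_of_nonneg hF ht x y
  · simpa [abs_of_nonpos ht] using h.neg.dist_le_of_nonneg hF.neg (neg_nonneg.2 ht) x y

theorem lipschitzWith (h : IsGlobalFlow F Ψ) (hF : LipschitzWith K F) (t : ℝ) :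
    LipschitzWith (Real.exp (K * |t|)).toNNReal (Ψ t) :=
  LipschitzWith.of_dist_le_mul fun x y => by
    rw [Real.coe_toNNReal _ (Real.exp_pos _).le, mul_comm]
    exact h.dist_le hF t x y

theorem neg_apply_apply (h : IsGlobalFlow F Ψ) (hF : LipschitzWith K F) (t : ℝ) (z : E) :
    Ψ (-t) (Ψ t z) = z := by
  rw [← h.map_add hF, neg_add_cancel, h.map_zero]

theorem apply_neg_apply (h : IsGlobalFlow F Ψ) (hF : LipschitzWith K F) (t : ℝ) (z : E) :
    Ψ t (Ψ (-t) z) = z := by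
  rw [← h.map_add hF, add_neg_cancel, h.map_zero]

/-- The time-`t` map of the flow as a homeomorphism. -/
def toHomeomorph (h : IsGlobalFlow F Ψ) (hF : LipschitzWith K F) (t : ℝ) : E ≃ₜ E where
  toFun := Ψ t
  invFun := Ψ (-t)
  left_inv := h.neg_apply_apply hF t
  right_inv := h.apply_neg_apply hF t
  continuous_toFun := (h.lipschitzWith hF t).continuous
  continuous_invFun := (h.lipschitzWith hF (-t)).continuous

theorem map_zero_of_field (h : IsGlobalFlow F Ψ) (hF : LipschitzWith K F) (h0 : F 0 = 0) (t : ℝ) :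
    Ψ t 0 = 0 := by
  have := ODE_solution_unique_univ (v := fun _ => F) (s := fun _ => univ) (K := K) (t₀ := 0)
    (f := fun s => Ψ s 0) (g := fun _ => 0) (fun _ => hF.lipschitzOnWith)
    (fun r => ⟨h.hasDerivAt 0 r, mem_univ _⟩)
    (fun r => ⟨by simpa [h0] using hasDerivAt_const r (0 : E), mem_univ _⟩) (by simp [h.map_zero])
  exact congrFun this t

theorem norm_le (h : IsGlobalFlow F Ψ) (hF : LipschitzWith K F) (h0 : F 0 = 0) (t : ℝ) (z : E) :
    ‖Ψ t z‖ ≤ ‖z‖ * Real.exp (K * |t|) := by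
  simpa [h.map_zero_of_field hF h0] using h.dist_le hF t z 0

end IsGlobalFlow

end LipschitzFlow

/-- Haar measure and the Hausdorff measure of full dimension have the same null sets, and a
Lipschitz map increases the latter by at most a constant factor. -/
theorem LipschitzWith.addHaar_image_eq_zero {E : Type*} [NormedAddCommGroup E]
    [NormedSpace ℝ E] [FiniteDimensional ℝ E] [MeasurableSpace E] [BorelSpace E]
    (μ : Measure E) [μ.IsAddHaarMeasure] {K : ℝ≥0} {G : E → E} (hG : LipschitzWith K G) {N : Set E}
    (hN : μ N = 0) : μ (G '' N) = 0 := by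
  have h1 : (Measure.hausdorffMeasure (Module.finrank ℝ E) : Measure E) ≪ μ :=
    Measure.absolutelyContinuous_isAddHaarMeasure _ _
  have h2 : μ ≪ (Measure.hausdorffMeasure (Module.finrank ℝ E) : Measure E) :=
    Measure.absolutelyContinuous_isAddHaarMeasure _ _
  apply h2
  have := hG.hausdorffMeasure_image_le (d := Module.finrank ℝ E) (by positivity) N
  rw [h1 hN, mul_zero] at this
  exact le_antisymm this zero_le

/-! ### Forward invariance of the domain and comparison with the flow of `f` -/

section Invariance

/-- Expand `‖x - y‖² ≤ ‖x - y - s u‖²`, divide by `s` and let `s → 0`. -/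
theorem inner_nonpos_of_forall_dist_le {E : Type*} [NormedAddCommGroup E] [InnerProductSpace ℝ E]
    {Ω : Set E} {x y u : E} (hy : ∀ w ∈ Ω, dist x y ≤ dist x w)
    (hu : ∀ᶠ s : ℝ in 𝓝[>] 0, y + s • u ∈ Ω) : inner ℝ (x - y) u ≤ 0 := by
  have hle : ∀ᶠ s : ℝ in 𝓝[>] 0, 2 * inner ℝ (x - y) u ≤ s * ‖u‖ ^ 2 := by
    filter_upwards [hu, self_mem_nhdsWithin] with s hs (hs0 : 0 < s)
    have h1 := hy _ hs
    rw [dist_eq_norm, dist_eq_norm, ← sub_sub] at h1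
    have h2 := pow_le_pow_left₀ (norm_nonneg _) h1 2
    rw [norm_sub_sq_real (x - y), inner_smul_right, norm_smul, Real.norm_of_nonneg hs0.le] at h2
    have h3 : s * (2 * inner ℝ (x - y) u) ≤ s * (s * ‖u‖ ^ 2) := by linarith
    exact le_of_mul_le_mul_left h3 hs0
  have hlim : Tendsto (fun s : ℝ => s * ‖u‖ ^ 2) (𝓝[>] 0) (𝓝 0) := by
    have : Tendsto (fun s : ℝ => s * ‖u‖ ^ 2) (𝓝 0) (𝓝 (0 * ‖u‖ ^ 2)) :=
      (continuous_id.mul continuous_const).tendsto 0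
    rw [zero_mul] at this
    exact this.mono_left nhdsWithin_le_nhds
  linarith [ge_of_tendsto hlim hle]

variable {d : ℕ} {Ω : Set (EuclideanSpace ℝ (Fin d))} {p u : EuclideanSpace ℝ (Fin d)}
  {ρ : EuclideanSpace ℝ (Fin d) → ℝ}

namespace IsLocalDefiningFunction

theorem tendsto_slope (h : IsLocalDefiningFunction Ω p ρ) (u : EuclideanSpace ℝ (Fin d)) :
    Tendsto (fun s : ℝ => s⁻¹ * ρ (p + s • u)) (𝓝[>] 0) (𝓝 (inner ℝ (gradient ρ p) u)) := by
  have hd : HasFDerivAt ρ (fderiv ℝ ρ p) p := (h.1.differentiable one_ne_zero p).hasFDerivAt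
  have hl : HasDerivAt (fun s : ℝ => ρ (p + s • u)) (fderiv ℝ ρ p u) 0 := hd.hasLineDerivAt u
  simpa [h.2.1, gradient, InnerProductSpace.toDual_symm_apply] using hl.tendsto_slope_zero_right

theorem eventually_mem (h : IsLocalDefiningFunction Ω p ρ) (hu : inner ℝ (gradient ρ p) u < 0) :
    ∀ᶠ s : ℝ in 𝓝[>] 0, p + s • u ∈ Ω := by
  have hc : Tendsto (fun s : ℝ => p + s • u) (𝓝[>] 0) (𝓝 p) := by
    have : Tendsto (fun s : ℝ => p + s • u) (𝓝 0) (𝓝 (p + (0 : ℝ) • u)) :=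
      (by fun_prop : Continuous fun s : ℝ => p + s • u).tendsto 0
    rw [zero_smul, add_zero] at this
    exact this.mono_left nhdsWithin_le_nhds
  filter_upwards [hc.eventually h.2.2.2, (h.tendsto_slope u).eventually (gt_mem_nhds hu),
    self_mem_nhdsWithin] with s h1 h2 (h3 : 0 < s)
  rw [h1]
  exact (pos_iff_neg_of_mul_neg h2).1 (inv_pos.2 h3)

/-- Shortly after leaving `p` along the gradient, `ρ` is positive on a whole neighborhood of the
point reached, so that point is outside the closure. -/
theorem notMem_interior_closure (h : IsLocalDefiningFunction Ω p ρ) :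
    p ∉ interior (closure Ω) := by
  intro hp
  have hc : Tendsto (fun s : ℝ => p + s • gradient ρ p) (𝓝[>] 0) (𝓝 p) := by
    have : Tendsto (fun s : ℝ => p + s • gradient ρ p) (𝓝 0) (𝓝 (p + (0 : ℝ) • gradient ρ p)) :=
      (by fun_prop : Continuous fun s : ℝ => p + s • gradient ρ p).tendsto 0
    rw [zero_smul, add_zero] at this
    exact this.mono_left nhdsWithin_le_nhds
  have hpos : 0 < inner ℝ (gradient ρ p) (gradient ρ p) := by
    rw [real_inner_self_eq_norm_sq]
    have := norm_pos_iff.2 h.2.2.1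
    positivity
  obtain ⟨s, h1, h2, h3, h4⟩ := ((hc.eventually h.2.2.2.eventually_nhds).and
    (((h.tendsto_slope (gradient ρ p)).eventually (lt_mem_nhds hpos)).and
      ((hc.eventually (isOpen_interior.mem_nhds hp)).and self_mem_nhdsWithin))).exists
  have h5 : 0 < ρ (p + s • gradient ρ p) := (pos_iff_pos_of_mul_pos h2).1 (inv_pos.2 h4)
  have h6 : ∀ᶠ x in 𝓝 (p + s • gradient ρ p), 0 < ρ x :=
    (h.1.continuous.tendsto _).eventually (lt_mem_nhds h5)
  obtain ⟨x, hx, h7, h8⟩ :=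
    ((mem_closure_iff_frequently.1 (interior_subset h3)).and_eventually (h1.and h6)).exists
  exact absurd (h7.1 hx) h8.not_gt

end IsLocalDefiningFunction

theorem HasC1Boundary.interior_closure (h : HasC1Boundary Ω) (hΩ : IsOpen Ω) :
    interior (closure Ω) = Ω := by
  refine Subset.antisymm (fun p hp => ?_) (hΩ.subset_interior_iff.2 subset_closure)
  by_contra hpΩ
  have hfr : p ∈ frontier Ω := by
    rw [hΩ.frontier_eq]
    exact ⟨interior_subset hp, hpΩ⟩
  obtain ⟨ρ, hρ⟩ := h p hfr
  exact hρ.notMem_interior_closure hp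

/-- The tangent condition controls the field in the direction of proximal normals. -/
theorem TangentCondition.inner_nonpos {F : EuclideanSpace ℝ (Fin d) → EuclideanSpace ℝ (Fin d)}
    (htan : TangentCondition Ω F) (hΩ : IsOpen Ω) (hb : HasC1Boundary Ω)
    {x y : EuclideanSpace ℝ (Fin d)} (hyΩ : y ∈ closure Ω)
    (hy : ∀ w ∈ Ω, dist x y ≤ dist x w) : inner ℝ (x - y) (F y) ≤ 0 := by
  by_cases hmem : y ∈ Ω
  · refine inner_nonpos_of_forall_dist_le hy ?_
    have : Tendsto (fun s : ℝ => y + s • F y) (𝓝 0) (𝓝 (y + (0 : ℝ) • F y)) :=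
      (by fun_prop : Continuous fun s : ℝ => y + s • F y).tendsto 0
    rw [zero_smul, add_zero] at this
    exact (this.mono_left nhdsWithin_le_nhds).eventually (hΩ.mem_nhds hmem)
  have hfr : y ∈ frontier Ω := by
    rw [hΩ.frontier_eq]
    exact ⟨hyΩ, hmem⟩
  obtain ⟨ρ, hρ⟩ := hb y hfr
  have hn : 0 < ‖gradient ρ y‖ := norm_pos_iff.2 hρ.2.2.1
  have h1 : inner ℝ (gradient ρ y) (F y) ≤ 0 := by
    have := htan y hfr _ ⟨ρ, hρ, rfl⟩
    rw [inner_smul_left] at this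
    exact nonpos_of_mul_nonpos_right this (by simpa using hn)
  -- The field may be tangent to the boundary, and then moving along it need not lead into `Ω`.
  -- Subtracting `ε • gradient ρ y` makes the direction strictly inward; afterwards `ε → 0`.
  have h2 : ∀ ε : ℝ, 0 < ε → inner ℝ (x - y) (F y - ε • gradient ρ y) ≤ 0 := by
    intro ε hε
    refine inner_nonpos_of_forall_dist_le hy (hρ.eventually_mem ?_)
    rw [inner_sub_right, inner_smul_right, real_inner_self_eq_norm_sq]
    have : 0 < ε * ‖gradient ρ y‖ ^ 2 := by positivity
    linarith
  have h3 : Tendsto (fun ε : ℝ => inner ℝ (x - y) (F y - ε • gradient ρ y)) (𝓝[>] 0)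
      (𝓝 (inner ℝ (x - y) (F y))) := by
    have : Tendsto (fun ε : ℝ => inner ℝ (x - y) (F y - ε • gradient ρ y)) (𝓝 0)
        (𝓝 (inner ℝ (x - y) (F y - (0 : ℝ) • gradient ρ y))) :=
      (by fun_prop : Continuous fun ε : ℝ =>
        inner ℝ (x - y) (F y - ε • gradient ρ y)).tendsto 0
    rw [zero_smul, sub_zero] at this
    exact this.mono_left nhdsWithin_le_nhds
  exact le_of_tendsto h3 (eventually_mem_nhdsWithin.mono h2)

/-- Under the tangent condition, the closure of `Ω` is forward invariant. -/
theorem IsGlobalFlow.mem_closure {F : EuclideanSpace ℝ (Fin d) → EuclideanSpace ℝ (Fin d)}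
    {Ψ : ℝ → EuclideanSpace ℝ (Fin d) → EuclideanSpace ℝ (Fin d)} {K : ℝ≥0}
    (h : IsGlobalFlow F Ψ) (hF : LipschitzWith K F) (htan : TangentCondition Ω F)
    (hΩ : IsOpen Ω) (hb : HasC1Boundary Ω) {z : EuclideanSpace ℝ (Fin d)} (hz : z ∈ closure Ω)
    {t : ℝ} (ht : 0 ≤ t) : Ψ t z ∈ closure Ω := by
  have hne : (closure Ω).Nonempty := ⟨z, hz⟩
  have hnear : ∀ x, ∃ y ∈ closure Ω, Metric.infDist x (closure Ω) = dist x y := fun x =>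
    isClosed_closure.exists_infDist_eq_dist hne x
  choose π hπ hdist using hnear
  have hmain := le_gronwallBound_of_liminf_deriv_right_le
    (f := fun t => Metric.infDist (Ψ t z) (closure Ω) ^ 2)
    (f' := fun t => 2 * inner ℝ (Ψ t z - π (Ψ t z)) (F (Ψ t z))) (δ := 0) (K := 2 * K) (ε := 0)
    (a := 0) (b := t)
    (((Metric.continuous_infDist_pt _).comp (h.continuous_time z)).pow 2).continuousOn
    ?_ (by simp [h.map_zero, Metric.infDist_zero_of_mem hz]) ?_ t ⟨ht, le_rfl⟩
  · rw [gronwallBound_ε0_δ0] at hmain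
    have h0 : Metric.infDist (Ψ t z) (closure Ω) = 0 :=
      pow_eq_zero_iff two_ne_zero |>.1 (le_antisymm hmain (sq_nonneg _))
    exact (isClosed_closure.mem_iff_infDist_zero hne).2 h0
  · intro s _ r hr
    -- The distance need not be differentiable. With the nearest point frozen at time `s`, the
    -- squared norm is smooth, dominates the squared distance and equals it at `s`, so its
    -- derivative bounds the right difference quotients.
    have hd : HasDerivAt (fun t => ‖Ψ t z - π (Ψ s z)‖ ^ 2)
        (2 * inner ℝ (Ψ s z - π (Ψ s z)) (F (Ψ s z))) s :=
      ((h.hasDerivAt z s).sub_const (π (Ψ s z))).norm_sq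
    have hslope := (hasDerivAt_iff_tendsto_slope.1 hd).mono_left
      (nhdsWithin_mono s (fun x (hx : s < x) => hx.ne'))
    refine Eventually.frequently ?_
    filter_upwards [hslope.eventually (gt_mem_nhds hr), self_mem_nhdsWithin] with q hq (hsq : s < q)
    refine lt_of_le_of_lt ?_ hq
    rw [slope_def_field, div_eq_inv_mul]
    have hpos : 0 < q - s := sub_pos.2 hsq
    have h1 : Metric.infDist (Ψ q z) (closure Ω) ≤ ‖Ψ q z - π (Ψ s z)‖ := by
      rw [← dist_eq_norm]
      exact Metric.infDist_le_dist_of_mem (hπ _)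
    have h2 : Metric.infDist (Ψ s z) (closure Ω) = ‖Ψ s z - π (Ψ s z)‖ := by
      rw [hdist, dist_eq_norm]
    have h3 : 0 ≤ Metric.infDist (Ψ q z) (closure Ω) := Metric.infDist_nonneg
    rw [h2]
    gcongr
  · intro s _
    set x := Ψ s z
    -- The field at `x` is compared with its value at the nearest point, where the tangent condition
    -- applies; the Lipschitz error is quadratic in the distance, as Grönwall requires.
    have h1 : inner ℝ (x - π x) (F (π x)) ≤ 0 :=
      htan.inner_nonpos hΩ hb (hπ x) fun w hw => by
        rw [← hdist]
        exact Metric.infDist_le_dist_of_mem (subset_closure hw)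
    have h2 : inner ℝ (x - π x) (F x - F (π x)) ≤ K * ‖x - π x‖ ^ 2 := by
      have := hF.dist_le_mul x (π x)
      rw [dist_eq_norm, dist_eq_norm] at this
      calc inner ℝ (x - π x) (F x - F (π x)) ≤ ‖x - π x‖ * ‖F x - F (π x)‖ :=
            real_inner_le_norm _ _
        _ ≤ ‖x - π x‖ * (K * ‖x - π x‖) := by gcongr
        _ = K * ‖x - π x‖ ^ 2 := by ring
    rw [inner_sub_right] at h2
    rw [hdist, dist_eq_norm]
    linarith

/-- The image of `Ω` under the homeomorphism `Ψ t` is an open subset of the closure, hence lies in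
the interior of the closure, which is `Ω`. -/
theorem IsGlobalFlow.mem_of_mem {F : EuclideanSpace ℝ (Fin d) → EuclideanSpace ℝ (Fin d)}
    {Ψ : ℝ → EuclideanSpace ℝ (Fin d) → EuclideanSpace ℝ (Fin d)} {K : ℝ≥0}
    (h : IsGlobalFlow F Ψ) (hF : LipschitzWith K F) (htan : TangentCondition Ω F)
    (hΩ : IsOpen Ω) (hb : HasC1Boundary Ω) {z : EuclideanSpace ℝ (Fin d)} (hz : z ∈ Ω)
    {t : ℝ} (ht : 0 ≤ t) : Ψ t z ∈ Ω := by
  have hopen : IsOpen (Ψ t '' Ω) := (h.toHomeomorph hF t).isOpenMap Ω hΩ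
  have hsub : Ψ t '' Ω ⊆ closure Ω := by
    rintro _ ⟨y, hy, rfl⟩
    exact h.mem_closure hF htan hΩ hb (subset_closure hy) ht
  rw [← hb.interior_closure hΩ]
  exact interior_maximal hsub hopen (mem_image_of_mem _ hz)

/-- Forward solutions of a `C¹` equation are unique. -/
theorem IsForwardSolution.eq {f : EuclideanSpace ℝ (Fin d) → EuclideanSpace ℝ (Fin d)}
    (hf : ContDiff ℝ 1 f) {z : EuclideanSpace ℝ (Fin d)} {x y : ℝ → EuclideanSpace ℝ (Fin d)}
    (hx : IsForwardSolution f z x) (hy : IsForwardSolution f z y) {t : ℝ} (ht : 0 ≤ t) :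
    x t = y t := by
  have hcx : ContinuousOn x (Icc 0 t) := fun s hs =>
    (hx.2 s hs.1).continuousWithinAt.mono Icc_subset_Ici_self
  have hcy : ContinuousOn y (Icc 0 t) := fun s hs =>
    (hy.2 s hs.1).continuousWithinAt.mono Icc_subset_Ici_self
  obtain ⟨R, hR⟩ := ((isCompact_Icc.image_of_continuousOn hcx).union
    (isCompact_Icc.image_of_continuousOn hcy)).isBounded.subset_closedBall 0
  obtain ⟨K, hK⟩ := hf.contDiffOn.exists_lipschitzOnWith (s := Metric.closedBall 0 R) one_ne_zero
    (convex_closedBall _ _) (isCompact_closedBall _ _)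
  refine ODE_solution_unique_of_mem_Icc_right (v := fun _ => f)
    (s := fun _ => Metric.closedBall 0 R) (fun _ _ => hK) hcx
    (fun s hs => (hx.2 s hs.1).mono (Ici_subset_Ici.2 hs.1))
    (fun s hs => hR (Or.inl (mem_image_of_mem _ (Ico_subset_Icc_self hs)))) hcy
    (fun s hs => (hy.2 s hs.1).mono (Ici_subset_Ici.2 hs.1))
    (fun s hs => hR (Or.inr (mem_image_of_mem _ (Ico_subset_Icc_self hs)))) ?_ ⟨ht, le_rfl⟩
  rw [hx.1, hy.1]

theorem isForwardSolution_flow {f : EuclideanSpace ℝ (Fin d) → EuclideanSpace ℝ (Fin d)}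
    {z : EuclideanSpace ℝ (Fin d)} {x : ℝ → EuclideanSpace ℝ (Fin d)}
    (hx : IsForwardSolution f z x) : IsForwardSolution f z fun t => flow f t z := by
  have hex : ∃ x, IsForwardSolution f z x := ⟨x, hx⟩
  have : (fun t => flow f t z) = hex.choose := by
    funext t
    exact dif_pos hex
  rw [this]
  exact hex.choose_spec

theorem IsForwardSolution.flow_eq {f : EuclideanSpace ℝ (Fin d) → EuclideanSpace ℝ (Fin d)}
    (hf : ContDiff ℝ 1 f) {z : EuclideanSpace ℝ (Fin d)} {x : ℝ → EuclideanSpace ℝ (Fin d)}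
    (hx : IsForwardSolution f z x) {t : ℝ} (ht : 0 ≤ t) : flow f t z = x t :=
  (isForwardSolution_flow hx).eq hf hx ht

/-- A `C¹` field agrees on a given ball with a bounded, globally Lipschitz field. -/
theorem exists_lipschitz_extension {f : EuclideanSpace ℝ (Fin d) → EuclideanSpace ℝ (Fin d)}
    (hf : ContDiff ℝ 1 f) (R : ℝ) :
    ∃ (F : EuclideanSpace ℝ (Fin d) → EuclideanSpace ℝ (Fin d)) (K C : ℝ≥0),
      LipschitzWith K F ∧ (∀ x, ‖F x‖ ≤ C) ∧ ∀ x ∈ Metric.closedBall 0 R, F x = f x := by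
  let χ : ContDiffBump (0 : EuclideanSpace ℝ (Fin d)) :=
    ⟨max R 1, max R 1 + 1, by positivity, by linarith⟩
  have hF : ContDiff ℝ 1 fun x => χ x • f x := χ.contDiff.smul hf
  have hs : HasCompactSupport fun x => χ x • f x := χ.hasCompactSupport.smul_right
  obtain ⟨K, hK⟩ := hF.lipschitzWith_of_hasCompactSupport hs one_ne_zero
  obtain ⟨C, hC⟩ := hs.exists_bound_of_continuous hF.continuous
  refine ⟨fun x => χ x • f x, K, C.toNNReal, hK,
    fun x => (hC x).trans (Real.le_coe_toNNReal C), fun x hx => ?_⟩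
  have : χ x = 1 := χ.one_of_mem_closedBall
    (Metric.closedBall_subset_closedBall (le_max_left R 1) hx)
  simp [this]

end Invariance

/-! ### Decay of the linearized equation -/

section LinearDecay

theorem tendsto_cexp_mul_pow_atTop {μ : ℂ} (hμ : μ.re < 0) (n : ℕ) :
    Tendsto (fun t : ℝ => Complex.exp (μ * t) * (t : ℂ) ^ n) atTop (𝓝 0) := by
  rw [tendsto_zero_iff_norm_tendsto_zero]
  have h := tendsto_rpow_mul_exp_neg_mul_atTop_nhds_zero n (-μ.re) (neg_pos.2 hμ)
  refine h.congr' ?_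
  filter_upwards [eventually_ge_atTop 0] with t ht
  rw [norm_mul, norm_pow, Complex.norm_exp, Complex.norm_real, Real.norm_of_nonneg ht,
    Real.rpow_natCast]
  simp [mul_comm]

/-- The polynomial solution `∑ tʲ/j! Nʲ v` of `q' = N q` for `N ^ (n + 1) v = 0`. -/
theorem hasDerivAt_sum_pow_smul {V : Type*} [NormedAddCommGroup V] [NormedSpace ℂ V]
    (N : Module.End ℂ V) (v : V) (n : ℕ) (hv : (N ^ (n + 1)) v = 0) (t : ℝ) :
    HasDerivAt
      (fun s : ℝ => ∑ j ∈ Finset.range (n + 1), ((s : ℂ) ^ j / (j.factorial : ℂ)) • (N ^ j) v)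
      (N (∑ j ∈ Finset.range (n + 1), ((t : ℂ) ^ j / (j.factorial : ℂ)) • (N ^ j) v)) t := by
  have hc : ∀ j : ℕ, HasDerivAt (fun s : ℝ => (s : ℂ) ^ (j + 1) / ((j + 1).factorial : ℂ))
      ((t : ℂ) ^ j / (j.factorial : ℂ)) t := by
    intro j
    have h1 : HasDerivAt (fun s : ℝ => (s : ℂ)) 1 t := Complex.ofRealCLM.hasDerivAt
    have h2 := (h1.pow (j + 1)).div_const ((j + 1).factorial : ℂ)
    refine h2.congr_deriv ?_
    have : ((j.factorial : ℕ) : ℂ) ≠ 0 := by exact_mod_cast j.factorial_ne_zero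
    have h3 : (j : ℂ) + 1 ≠ 0 := by exact_mod_cast j.succ_ne_zero
    rw [Nat.factorial_succ]
    push_cast
    field_simp
  have hN : N (∑ j ∈ Finset.range (n + 1), ((t : ℂ) ^ j / (j.factorial : ℂ)) • (N ^ j) v) =
      ∑ j ∈ Finset.range n, ((t : ℂ) ^ j / (j.factorial : ℂ)) • (N ^ (j + 1)) v := by
    have hs : ∀ j, N ((N ^ j) v) = (N ^ (j + 1)) v := fun j => by
      rw [pow_succ', Module.End.mul_apply]
    rw [map_sum, Finset.sum_range_succ]
    simp only [map_smul, hs, hv, smul_zero, add_zero]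
  rw [hN]
  simp only [Finset.sum_range_succ' _ n, pow_zero, Nat.factorial_zero, Nat.cast_one, div_one]
  exact (HasDerivAt.fun_sum fun j _ => (hc j).smul_const ((N ^ (j + 1)) v)).add_const _

/-- The initial values from which `y' = B y` has a solution tending to `0`. -/
def decayingSubmodule {V : Type*} [NormedAddCommGroup V] [NormedSpace ℂ V]
    (B : Module.End ℂ V) : Submodule ℂ V where
  carrier := {v | ∃ y : ℝ → V, y 0 = v ∧ (∀ t, HasDerivAt y (B (y t)) t) ∧
    Tendsto y atTop (𝓝 0)}
  zero_mem' := ⟨fun _ => 0, rfl, fun t => by simpa using hasDerivAt_const t (0 : V),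
    tendsto_const_nhds⟩
  add_mem' := by
    rintro _ _ ⟨y, rfl, h1, h2⟩ ⟨x, rfl, h3, h4⟩
    exact ⟨fun t => y t + x t, rfl, fun t => by simpa using (h1 t).fun_add (h3 t),
      by simpa using h2.add h4⟩
  smul_mem' := by
    rintro c _ ⟨y, rfl, h1, h2⟩
    exact ⟨fun t => c • y t, rfl, fun t => by simpa using (h1 t).fun_const_smul c,
      by simpa using h2.const_smul c⟩

/-- The solution is `e^{μt}` times the polynomial solution for `N = B - μ`, and the exponential
beats every power of `t`. -/
theorem mem_decayingSubmodule_of_pow_eq_zero {V : Type*} [NormedAddCommGroup V] [NormedSpace ℂ V]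
    {B : Module.End ℂ V} {μ : ℂ} (hμ : μ.re < 0) {n : ℕ} {v : V}
    (hv : ((B - algebraMap ℂ (Module.End ℂ V) μ) ^ (n + 1)) v = 0) : v ∈ decayingSubmodule B := by
  set N := B - algebraMap ℂ (Module.End ℂ V) μ with hN
  let q : ℝ → V := fun s =>
    ∑ j ∈ Finset.range (n + 1), ((s : ℂ) ^ j / (j.factorial : ℂ)) • (N ^ j) v
  have hq : ∀ t, HasDerivAt q (N (q t)) t := hasDerivAt_sum_pow_smul N v n hv
  have hB : ∀ x, B x = μ • x + N x := fun x => by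
    simp [hN, Module.algebraMap_end_apply]
  refine ⟨fun t => Complex.exp (μ * t) • q t, ?_, fun t => ?_, ?_⟩
  · simp [q, Finset.sum_range_succ']
  · have h1 : HasDerivAt (fun s : ℝ => (s : ℂ)) 1 t := Complex.ofRealCLM.hasDerivAt
    have h2 := ((h1.const_mul μ).cexp).fun_smul (hq t)
    refine h2.congr_deriv ?_
    rw [map_smul, hB, smul_add, smul_smul, mul_one, add_comm]
  · have h : ∀ j ∈ Finset.range (n + 1), Tendsto (fun t : ℝ =>
        ((Complex.exp (μ * t) * (t : ℂ) ^ j) * (j.factorial : ℂ)⁻¹) • (N ^ j) v) atTop (𝓝 0) := by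
      intro j _
      simpa using ((tendsto_cexp_mul_pow_atTop hμ j).mul_const ((j.factorial : ℂ)⁻¹)).smul_const
        ((N ^ j) v)
    have h2 := tendsto_finsetSum _ h
    simp only [Finset.sum_const_zero] at h2
    refine h2.congr fun t => ?_
    simp only [q, Finset.smul_sum, smul_smul, div_eq_mul_inv, mul_assoc]

/-- Decaying initial values form a subspace, so it suffices to treat generalized eigenvectors, which
span the space. -/
theorem decayingSubmodule_eq_top {V : Type*} [NormedAddCommGroup V] [NormedSpace ℂ V]
    [FiniteDimensional ℂ V] {B : Module.End ℂ V} (hB : ∀ μ, B.HasEigenvalue μ → μ.re < 0) :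
    decayingSubmodule B = ⊤ := by
  rw [eq_top_iff, ← Module.End.iSup_maxGenEigenspace_eq_top B]
  refine iSup_le fun μ v hv => ?_
  obtain ⟨n, hn⟩ := (Module.End.mem_maxGenEigenspace B μ v).1 hv
  rw [← Algebra.algebraMap_eq_smul_one] at hn
  by_cases hμ : B.HasEigenvalue μ
  · refine mem_decayingSubmodule_of_pow_eq_zero (hB μ hμ) (n := n) ?_
    rw [pow_succ', Module.End.mul_apply, hn, map_zero]
  -- If `μ` is not an eigenvalue, `B - μ` and its powers are injective, so the generalized
  -- eigenvector is `0`.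
  · have hker : LinearMap.ker (B - algebraMap ℂ (Module.End ℂ V) μ) = ⊥ := by
      rw [Module.End.hasEigenvalue_iff, not_not, Module.End.eigenspace_def] at hμ
      exact hμ
    have hinj : Function.Injective ⇑((B - algebraMap ℂ (Module.End ℂ V) μ) ^ n) := by
      rw [Module.End.coe_pow]
      exact (LinearMap.ker_eq_bot.1 hker).iterate n
    rw [hinj (hn.trans (map_zero _).symm)]
    exact zero_mem _

variable {d : ℕ}

/-- If all eigenvalues of `A` have negative real part, then solutions of `y' = A y` decay. -/
theorem exists_decaying_solution {A : Matrix (Fin d) (Fin d) ℝ}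
    (hA : ∀ μ : ℂ, Module.End.HasEigenvalue
      (Matrix.toLin' (A.map (algebraMap ℝ ℂ))) μ → μ.re < 0) (z : EuclideanSpace ℝ (Fin d)) :
    ∃ y : ℝ → EuclideanSpace ℝ (Fin d), y 0 = z ∧
      (∀ t, HasDerivAt y (Matrix.toEuclideanLin A (y t)) t) ∧ Tendsto y atTop (𝓝 0) := by
  -- As `A` is real, the real part of a complex solution is a solution.
  let reMap : (Fin d → ℂ) →L[ℝ] EuclideanSpace ℝ (Fin d) :=
    ((PiLp.continuousLinearEquiv 2 ℝ fun _ : Fin d => ℝ).symm :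
      (Fin d → ℝ) →L[ℝ] EuclideanSpace ℝ (Fin d)).comp
      (ContinuousLinearMap.pi fun j => Complex.reCLM.comp (ContinuousLinearMap.proj j))
  have hre : ∀ (x : Fin d → ℂ) (j : Fin d), reMap x j = (x j).re := fun _ _ => rfl
  have hcomm : ∀ x, reMap (Matrix.toLin' (A.map (algebraMap ℝ ℂ)) x) =
      Matrix.toEuclideanLin A (reMap x) := by
    intro x
    ext j
    rw [hre, Matrix.toLin'_apply, Matrix.toLpLin_apply]
    simp [Matrix.mulVec, dotProduct, hre]
  have hmem : (fun j => (z j : ℂ)) ∈ decayingSubmodule (Matrix.toLin' (A.map (algebraMap ℝ ℂ))) := by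
    rw [decayingSubmodule_eq_top hA]
    trivial
  obtain ⟨Y, h0, h1, h2⟩ := hmem
  refine ⟨fun t => reMap (Y t), ?_, fun t => ?_, ?_⟩
  · ext j
    simp [h0, hre]
  · rw [← hcomm]
    exact reMap.hasFDerivAt.comp_hasDerivAt t (h1 t)
  · simpa [Function.comp_def] using (reMap.continuous.tendsto 0).comp h2

/-- A decaying linear equation is a contraction after some time. -/
theorem exists_linear_contraction
    {A : EuclideanSpace ℝ (Fin d) →ₗ[ℝ] EuclideanSpace ℝ (Fin d)}
    (hA : ∀ z, ∃ y : ℝ → EuclideanSpace ℝ (Fin d), y 0 = z ∧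
      (∀ t, HasDerivAt y (A (y t)) t) ∧ Tendsto y atTop (𝓝 0)) :
    ∃ T C : ℝ, 0 < T ∧ 0 < C ∧ ∀ z, ∃ y : ℝ → EuclideanSpace ℝ (Fin d), y 0 = z ∧
      (∀ t, HasDerivAt y (A (y t)) t) ∧ (∀ t ∈ Icc 0 T, ‖y t‖ ≤ C * ‖z‖) ∧
      ‖y T‖ ≤ 1 / 4 * ‖z‖ := by
  choose Y h0 h1 h2 using fun i : Fin d => hA (EuclideanSpace.single i 1)
  -- By linearity `g t` bounds the norm of the time-`t` solution operator, which turns decay of each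
  -- basis solution into uniform decay.
  let g : ℝ → ℝ := fun t => ∑ i, ‖Y i t‖
  have hY : ∀ i, Continuous (Y i) := fun i =>
    continuous_iff_continuousAt.2 fun t => (h1 i t).continuousAt
  have hg : Continuous g := by fun_prop
  have hg0 : Tendsto g atTop (𝓝 0) := by
    have := tendsto_finsetSum Finset.univ fun i _ => (h2 i).norm
    simpa using this
  obtain ⟨T, hT1, hT⟩ := ((eventually_gt_atTop (0 : ℝ)).and
    (hg0.eventually (ge_mem_nhds (by norm_num : (0 : ℝ) < 1 / 4)))).exists
  obtain ⟨C, hC⟩ := (isCompact_Icc (a := (0 : ℝ)) (b := T)).bddAbove_image hg.continuousOn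
  refine ⟨T, max C 1, hT1, by positivity, fun z => ⟨fun t => ∑ i, z i • Y i t, ?_, fun t => ?_, ?_⟩⟩
  · simp only [h0]
    ext j
    simp [Pi.single_apply]
  · simp only [map_sum, map_smul]
    exact HasDerivAt.fun_sum fun i _ => (h1 i t).fun_const_smul (z i)
  have hle : ∀ t, ‖∑ i, z i • Y i t‖ ≤ g t * ‖z‖ := by
    intro t
    rw [Finset.sum_mul]
    refine norm_sum_le_of_le _ fun i _ => ?_
    rw [norm_smul, mul_comm]
    gcongr
    exact PiLp.norm_apply_le z i
  refine ⟨fun t ht => (hle t).trans ?_, (hle T).trans ?_⟩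
  · gcongr
    exact (hC (mem_image_of_mem _ ht)).trans (le_max_left _ _)
  · gcongr

end LinearDecay

/-! ### Exponential decay of the nonlinear flow -/

section NonlinearDecay

/-- Makes the deviation from the linear solution proportional to `‖z‖`, because the defect `ε` will
be. -/
theorem gronwallBound_zero_eq_mul (K ε x : ℝ) :
    gronwallBound 0 K ε x = ε * gronwallBound 0 K 1 x := by
  unfold gronwallBound
  split_ifs <;> ring

variable {d : ℕ} {F : EuclideanSpace ℝ (Fin d) → EuclideanSpace ℝ (Fin d)}
  {Ψ : ℝ → EuclideanSpace ℝ (Fin d) → EuclideanSpace ℝ (Fin d)} {K : ℝ≥0}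

/-- Linearized stability: near `0` the flow halves the norm after some time. -/
theorem IsGlobalFlow.exists_norm_le_half (h : IsGlobalFlow F Ψ) (hF : LipschitzWith K F)
    {A : EuclideanSpace ℝ (Fin d) →ₗ[ℝ] EuclideanSpace ℝ (Fin d)}
    (hA : ∀ z, ∃ y : ℝ → EuclideanSpace ℝ (Fin d), y 0 = z ∧
      (∀ t, HasDerivAt y (A (y t)) t) ∧ Tendsto y atTop (𝓝 0))
    (hFA : (fun x => F x - A x) =o[𝓝 0] fun x : EuclideanSpace ℝ (Fin d) => x) :
    ∃ δ T : ℝ, 0 < δ ∧ 0 < T ∧ ∀ z, ‖z‖ ≤ δ → ‖Ψ T z‖ ≤ 1 / 2 * ‖z‖ := by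
  obtain ⟨T, C, hT, hC, hy⟩ := exists_linear_contraction hA
  set G := gronwallBound 0 K 1 T
  have hG : 0 ≤ G := by
    have := gronwallBound_mono (δ := 0) (ε := 1) (K := K) le_rfl zero_le_one K.2 hT.le
    rwa [gronwallBound_x0] at this
  -- Chosen so that the deviation at time `T` is at most `‖z‖ / 4`; with the linear bound `‖z‖ / 4`
  -- this gives one half. The `+ 1` keeps the denominator positive.
  set ε := 1 / (4 * C * (G + 1))
  have hε : 0 < ε := by positivity
  have hεG : ε * C * G ≤ 1 / 4 := by
    have : ε * C * G = 1 / 4 * (G / (G + 1)) := by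
      simp only [ε]
      field_simp
    rw [this]
    have : G / (G + 1) ≤ 1 := (div_le_one (by positivity)).2 (by linarith)
    linarith
  obtain ⟨δ₀, hδ₀, hball⟩ := Metric.eventually_nhds_iff_ball.1 (hFA.def hε)
  refine ⟨δ₀ / (2 * C), T, by positivity, hT, fun z hz => ?_⟩
  obtain ⟨y, h0, h1, h2, h3⟩ := hy z
  have hcy : Continuous y := continuous_iff_continuousAt.2 fun t => (h1 t).continuousAt
  -- The linear solution is treated as an approximate solution for `F`. Only it has to stay in the
  -- small ball, since `F` is globally Lipschitz.
  have hsmall : ∀ t ∈ Ico 0 T, dist (A (y t)) (F (y t)) ≤ ε * (C * ‖z‖) := by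
    intro t ht
    have h4 := h2 t (Ico_subset_Icc_self ht)
    have h5 : y t ∈ Metric.ball 0 δ₀ := by
      rw [mem_ball_zero_iff]
      calc ‖y t‖ ≤ C * ‖z‖ := h4
        _ ≤ C * (δ₀ / (2 * C)) := by gcongr
        _ = δ₀ / 2 := by field_simp
        _ < δ₀ := half_lt_self hδ₀
    rw [dist_comm, dist_eq_norm]
    exact (hball _ h5).trans (by gcongr)
  have hdist := dist_le_of_approx_trajectories_ODE (v := fun _ => F) (K := K) (a := 0) (b := T)
    (f := y) (g := fun s => Ψ s z) (f' := fun t => A (y t)) (g' := fun t => F (Ψ t z))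
    (εf := ε * (C * ‖z‖)) (εg := 0) (δ := 0) (fun _ => hF)
    hcy.continuousOn (fun t _ => (h1 t).hasDerivWithinAt) hsmall
    (h.continuous_time z).continuousOn (fun t _ => (h.hasDerivAt z t).hasDerivWithinAt)
    (fun t _ => by simp) (by simp [h0, h.map_zero]) T ⟨hT.le, le_rfl⟩
  rw [add_zero, sub_zero, gronwallBound_zero_eq_mul, dist_comm, dist_eq_norm] at hdist
  calc ‖Ψ T z‖ = ‖(Ψ T z - y T) + y T‖ := by rw [sub_add_cancel]
    _ ≤ ‖Ψ T z - y T‖ + ‖y T‖ := norm_add_le _ _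
    _ ≤ ε * (C * ‖z‖) * G + 1 / 4 * ‖z‖ := add_le_add hdist h3
    _ = (ε * C * G) * ‖z‖ + 1 / 4 * ‖z‖ := by ring
    _ ≤ 1 / 4 * ‖z‖ + 1 / 4 * ‖z‖ := by gcongr
    _ = 1 / 2 * ‖z‖ := by ring

theorem IsGlobalFlow.exists_local_exponential_bound (h : IsGlobalFlow F Ψ)
    (hF : LipschitzWith K F) (h0 : F 0 = 0) {δ T : ℝ} (hT : 0 < T)
    (hhalf : ∀ z, ‖z‖ ≤ δ → ‖Ψ T z‖ ≤ 1 / 2 * ‖z‖) :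
    ∃ M ω : ℝ, 0 < M ∧ 0 < ω ∧ ∀ z, ‖z‖ ≤ δ → ∀ t, 0 ≤ t →
      ‖Ψ t z‖ ≤ M * Real.exp (-ω * t) * ‖z‖ := by
  -- The norm halves in each period `T`, hence the rate. The factor `2` pays for rounding `t / T`
  -- down, and `exp (K * T)` for the growth during the remaining time.
  refine ⟨2 * Real.exp (K * T), Real.log 2 / T, by positivity,
    div_pos (Real.log_pos one_lt_two) hT, fun z hz t ht => ?_⟩
  have hiter : ∀ n : ℕ, ‖Ψ (n * T) z‖ ≤ (1 / 2) ^ n * ‖z‖ := by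
    intro n
    induction n with
    | zero => simp [h.map_zero]
    | succ n ih =>
      have h1 : ‖Ψ (n * T) z‖ ≤ δ := by
        refine (ih.trans ?_).trans hz
        exact mul_le_of_le_one_left (norm_nonneg z) (pow_le_one₀ (by norm_num) (by norm_num))
      have h2 : Ψ ((n + 1 : ℕ) * T) z = Ψ T (Ψ (n * T) z) := by
        rw [← h.map_add hF]
        congr 1
        push_cast
        ring
      rw [h2]
      calc _ ≤ 1 / 2 * ‖Ψ (n * T) z‖ := hhalf _ h1
        _ ≤ 1 / 2 * ((1 / 2) ^ n * ‖z‖) := by gcongr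
        _ = (1 / 2) ^ (n + 1) * ‖z‖ := by ring
  set n := ⌊t / T⌋₊
  have hn1 : (n : ℝ) * T ≤ t := (le_div_iff₀ hT).1 (Nat.floor_le (by positivity))
  have hn2 : t / T < n + 1 := Nat.lt_floor_add_one _
  have hn3 : t - n * T ≤ T := by
    have := (div_lt_iff₀ hT).1 hn2
    linarith
  have hsplit : Ψ t z = Ψ (t - n * T) (Ψ (n * T) z) := by
    rw [← h.map_add hF, sub_add_cancel]
  have hexp : (1 / 2 : ℝ) ^ n ≤ 2 * Real.exp (-(Real.log 2 / T) * t) := by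
    have h1 : (1 / 2 : ℝ) ^ n = Real.exp (-(Real.log 2) * n) := by
      rw [mul_comm, Real.exp_nat_mul, Real.exp_neg, Real.exp_log two_pos, one_div]
    have h2 : (2 : ℝ) * Real.exp (-(Real.log 2 / T) * t) =
        Real.exp (Real.log 2 + -(Real.log 2 / T) * t) := by
      rw [Real.exp_add, Real.exp_log two_pos]
    rw [h1, h2, Real.exp_le_exp]
    have h3 : Real.log 2 * (t / T) ≤ Real.log 2 * (n + 1) :=
      mul_le_mul_of_nonneg_left hn2.le (Real.log_pos one_lt_two).le
    have h4 : Real.log 2 / T * t = Real.log 2 * (t / T) := by ring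
    linarith
  calc ‖Ψ t z‖ ≤ ‖Ψ (n * T) z‖ * Real.exp (K * |t - n * T|) := by
        rw [hsplit]
        exact h.norm_le hF h0 _ _
    _ ≤ ((2 * Real.exp (-(Real.log 2 / T) * t)) * ‖z‖) * Real.exp (K * T) := by
        gcongr
        · exact (hiter n).trans (by gcongr)
        · rwa [abs_of_nonneg (by linarith)]
    _ = 2 * Real.exp (K * T) * Real.exp (-(Real.log 2 / T) * t) * ‖z‖ := by ring

/-- A local exponential bound is uniform on a compact set from which every orbit enters the
neighborhood where it holds. -/
theorem IsGlobalFlow.exists_exponential_bound (h : IsGlobalFlow F Ψ)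
    (hF : LipschitzWith K F) (h0 : F 0 = 0) {S : Set (EuclideanSpace ℝ (Fin d))}
    (hS : IsCompact S) {δ M ω : ℝ} (hM : 0 < M) (hω : 0 < ω)
    (hloc : ∀ z, ‖z‖ ≤ δ → ∀ t, 0 ≤ t → ‖Ψ t z‖ ≤ M * Real.exp (-ω * t) * ‖z‖)
    (henter : ∀ z ∈ S, ∃ t, 0 ≤ t ∧ ‖Ψ t z‖ < δ) :
    ∃ M', 0 < M' ∧ ∀ z ∈ S, ∀ t, 0 ≤ t → ‖Ψ t z‖ ≤ M' * Real.exp (-ω * t) * ‖z‖ := by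
  -- For fixed `t`, having `‖Ψ t z‖ < δ` is an open condition on `z`, so finitely many entry times
  -- suffice on the compact set.
  have hunif : ∃ τ : ℝ, 0 ≤ τ ∧ ∀ z ∈ S, ∃ t ∈ Icc 0 τ, ‖Ψ t z‖ < δ := by
    refine hS.induction_on ⟨0, le_rfl, by simp⟩ ?_ ?_ ?_
    · rintro s s' hss' ⟨τ, hτ, h1⟩
      exact ⟨τ, hτ, fun z hz => h1 z (hss' hz)⟩
    · rintro s s' ⟨τ, hτ, h1⟩ ⟨τ', hτ', h1'⟩
      refine ⟨max τ τ', hτ.trans (le_max_left _ _), ?_⟩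
      rintro z (hz | hz)
      · obtain ⟨t, ht, h2⟩ := h1 z hz
        exact ⟨t, ⟨ht.1, ht.2.trans (le_max_left _ _)⟩, h2⟩
      · obtain ⟨t, ht, h2⟩ := h1' z hz
        exact ⟨t, ⟨ht.1, ht.2.trans (le_max_right _ _)⟩, h2⟩
    · intro z hz
      obtain ⟨t, ht, h1⟩ := henter z hz
      have h2 : ∀ᶠ y in 𝓝 z, ‖Ψ t y‖ < δ :=
        ((h.lipschitzWith hF t).continuous.norm.tendsto z).eventually (gt_mem_nhds h1)
      exact ⟨{y | ‖Ψ t y‖ < δ}, mem_nhdsWithin_of_mem_nhds h2, t, ht,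
        fun y hy => ⟨t, ⟨ht, le_rfl⟩, hy⟩⟩
  obtain ⟨τ, hτ, hunif⟩ := hunif
  -- `exp (K * τ)` bounds the growth up to entry and `exp (ω * τ)` makes up for the decay starting
  -- late. `M + 1` dominates both `M`, needed after entry, and `1`, needed before.
  refine ⟨(M + 1) * Real.exp (ω * τ) * Real.exp (K * τ), by positivity, fun z hz t ht => ?_⟩
  obtain ⟨s, hs, hsδ⟩ := hunif z hz
  have hgrow : ∀ r, 0 ≤ r → r ≤ τ → ‖Ψ r z‖ ≤ ‖z‖ * Real.exp (K * τ) := by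
    intro r hr0 hr
    refine (h.norm_le hF h0 r z).trans ?_
    rw [abs_of_nonneg hr0]
    gcongr
  have key : ∀ r, r ≤ τ → Real.exp (-ω * (t - r)) ≤ Real.exp (ω * τ) * Real.exp (-ω * t) := by
    intro r hr
    rw [← Real.exp_add, Real.exp_le_exp]
    nlinarith
  rcases le_total s t with hst | hst
  · have hsplit : Ψ t z = Ψ (t - s) (Ψ s z) := by rw [← h.map_add hF, sub_add_cancel]
    calc ‖Ψ t z‖ ≤ M * Real.exp (-ω * (t - s)) * ‖Ψ s z‖ := by
          rw [hsplit]
          exact hloc _ hsδ.le _ (sub_nonneg.2 hst)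
      _ ≤ (M + 1) * (Real.exp (ω * τ) * Real.exp (-ω * t)) * (‖z‖ * Real.exp (K * τ)) := by
          gcongr
          · linarith
          · exact key s hs.2
          · exact hgrow s hs.1 hs.2
      _ = _ := by ring
  · calc ‖Ψ t z‖ ≤ 1 * 1 * (‖z‖ * Real.exp (K * τ)) := by
          simpa using hgrow t ht (hst.trans hs.2)
      _ ≤ (M + 1) * (Real.exp (ω * τ) * Real.exp (-ω * t)) * (‖z‖ * Real.exp (K * τ)) := by
          gcongr
          · linarith
          · simpa using key t (hst.trans hs.2)
      _ = _ := by ring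

/-- An orbit of finite cost enters every neighborhood of `0`. -/
theorem exists_norm_flow_lt_of_costFunctional_lt_top
    {f : EuclideanSpace ℝ (Fin d) → EuclideanSpace ℝ (Fin d)} {z : EuclideanSpace ℝ (Fin d)}
    (hv : costFunctional f (fun x => ‖x‖₊ ^ 2) z < ∞) {δ : ℝ} (hδ : 0 < δ) :
    ∃ t, 0 < t ∧ ‖flow f t z‖ < δ := by
  by_contra! hcon
  refine hv.ne (top_le_iff.1 ?_)
  -- An orbit that stays outside the ball has cost density at least `δ ^ 2` on a half-line of
  -- infinite length.
  have hle : ∫⁻ _ in Ioi (0 : ℝ), ((δ.toNNReal ^ 2 : ℝ≥0) : ℝ≥0∞) ≤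
      costFunctional f (fun x => ‖x‖₊ ^ 2) z := by
    refine setLIntegral_mono' measurableSet_Ioi fun t ht => ?_
    rw [ENNReal.coe_le_coe]
    exact pow_le_pow_left' (Real.toNNReal_le_iff_le_coe.2 (hcon t ht)) 2
  refine le_trans (le_of_eq ?_) hle
  rw [setLIntegral_const, Real.volume_Ioi, ENNReal.mul_top]
  have : 0 < δ.toNNReal := Real.toNNReal_pos.2 hδ
  positivity

end NonlinearDecay

/-! ### Composition operators on the weighted space -/

section CompositionOperator

namespace WeightedLinfty

variable {d : ℕ} {Ω : Set (EuclideanSpace ℝ (Fin d))} {w : EuclideanSpace ℝ (Fin d) → ℝ}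
  {θ : EuclideanSpace ℝ (Fin d) → EuclideanSpace ℝ (Fin d)} {C : ℝ≥0}

theorem ext_of_ae {φ ψ : WeightedLinfty Ω w} (h : φ.toFun =ᵐ[volume.restrict Ω] ψ.toFun) :
    φ = ψ :=
  Subtype.ext (AEEqFun.ext h)

/-- Replacing `w z` by `C * w (θ z)` leaves `g * w` evaluated at `θ z`; quasi-preservation pulls its
almost everywhere bound back along `θ`. -/
theorem eLpNormEssSup_comp_le
    (hθ : Measure.QuasiMeasurePreserving θ (volume.restrict Ω) (volume.restrict Ω))
    (hC : ∀ᵐ z ∂(volume.restrict Ω), ‖w z‖ ≤ C * ‖w (θ z)‖)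
    (g : EuclideanSpace ℝ (Fin d) → ℝ) :
    eLpNormEssSup (fun z => g (θ z) * w z) (volume.restrict Ω) ≤
      C * eLpNormEssSup (fun z => g z * w z) (volume.restrict Ω) := by
  refine eLpNormEssSup_le_of_ae_enorm_bound ?_
  filter_upwards [hC, hθ.ae (enorm_ae_le_eLpNormEssSup (fun z => g z * w z) (volume.restrict Ω))]
    with z h1 h2
  have h3 : ‖w z‖ₑ ≤ C * ‖w (θ z)‖ₑ := by
    have : ‖w z‖₊ ≤ C * ‖w (θ z)‖₊ := h1
    rw [enorm_eq_nnnorm, enorm_eq_nnnorm]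
    exact_mod_cast this
  calc ‖g (θ z) * w z‖ₑ = ‖g (θ z)‖ₑ * ‖w z‖ₑ := enorm_mul _ _
    _ ≤ ‖g (θ z)‖ₑ * (C * ‖w (θ z)‖ₑ) := by gcongr
    _ = C * ‖g (θ z) * w (θ z)‖ₑ := by rw [enorm_mul]; ring
    _ ≤ _ := by gcongr

/-- The composition operator `φ ↦ φ ∘ θ`. -/
noncomputable def compLinearMap
    (hθ : Measure.QuasiMeasurePreserving θ (volume.restrict Ω) (volume.restrict Ω))
    (hC : ∀ᵐ z ∂(volume.restrict Ω), ‖w z‖ ≤ C * ‖w (θ z)‖) :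
    WeightedLinfty Ω w →ₗ[ℝ] WeightedLinfty Ω w where
  toFun φ := ⟨AEEqFun.compQuasiMeasurePreserving φ.1 θ hθ, by
    have h : eLpNormEssSup (fun x => AEEqFun.compQuasiMeasurePreserving φ.1 θ hθ x * w x)
        (volume.restrict Ω) =
        eLpNormEssSup (fun z => φ.toFun (θ z) * w z) (volume.restrict Ω) := by
      apply eLpNormEssSup_congr_ae
      filter_upwards [AEEqFun.coeFn_compQuasiMeasurePreserving φ.1 hθ] with x hx
      rw [hx]
      rfl
    change eLpNormEssSup _ _ < ∞
    rw [h]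
    exact (eLpNormEssSup_comp_le hθ hC φ.toFun).trans_lt
      (ENNReal.mul_lt_top ENNReal.coe_lt_top φ.2)⟩
  map_add' φ ψ := by
    apply ext_of_ae
    refine (AEEqFun.coeFn_compQuasiMeasurePreserving _ hθ).trans ?_
    refine EventuallyEq.trans ?_ (toFun_add _ _).symm
    filter_upwards [hθ.ae_eq_comp (toFun_add φ ψ),
      AEEqFun.coeFn_compQuasiMeasurePreserving φ.1 hθ,
      AEEqFun.coeFn_compQuasiMeasurePreserving ψ.1 hθ] with z h1 h2 h3
    exact h1.trans (congrArg₂ (· + ·) h2.symm h3.symm)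
  map_smul' c φ := by
    apply ext_of_ae
    refine (AEEqFun.coeFn_compQuasiMeasurePreserving _ hθ).trans ?_
    refine EventuallyEq.trans ?_ (toFun_smul _ _).symm
    filter_upwards [hθ.ae_eq_comp (toFun_smul c φ),
      AEEqFun.coeFn_compQuasiMeasurePreserving φ.1 hθ] with z h1 h2
    exact h1.trans (congrArg (c • ·) h2.symm)

theorem toFun_compLinearMap
    (hθ : Measure.QuasiMeasurePreserving θ (volume.restrict Ω) (volume.restrict Ω))
    (hC : ∀ᵐ z ∂(volume.restrict Ω), ‖w z‖ ≤ C * ‖w (θ z)‖) (φ : WeightedLinfty Ω w) :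
    (compLinearMap hθ hC φ).toFun =ᵐ[volume.restrict Ω] fun z => φ.toFun (θ z) :=
  AEEqFun.coeFn_compQuasiMeasurePreserving φ.1 hθ

theorem norm_compLinearMap_le
    (hθ : Measure.QuasiMeasurePreserving θ (volume.restrict Ω) (volume.restrict Ω))
    (hC : ∀ᵐ z ∂(volume.restrict Ω), ‖w z‖ ≤ C * ‖w (θ z)‖) (φ : WeightedLinfty Ω w) :
    ‖compLinearMap hθ hC φ‖ ≤ C * ‖φ‖ := by
  have h : eLpNormEssSup (fun x => (compLinearMap hθ hC φ).toFun x * w x) (volume.restrict Ω) =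
      eLpNormEssSup (fun z => φ.toFun (θ z) * w z) (volume.restrict Ω) := by
    apply eLpNormEssSup_congr_ae
    filter_upwards [toFun_compLinearMap hθ hC φ] with x hx
    rw [hx]
  rw [norm_def, norm_def, h, ← ENNReal.coe_toReal C, ← ENNReal.toReal_mul]
  exact ENNReal.toReal_mono (ENNReal.mul_ne_top ENNReal.coe_ne_top φ.2.ne)
    (eLpNormEssSup_comp_le hθ hC φ.toFun)

/-- The composition operator `φ ↦ φ ∘ θ` as a bounded operator. -/
noncomputable def compCLM
    (hθ : Measure.QuasiMeasurePreserving θ (volume.restrict Ω) (volume.restrict Ω))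
    (hC : ∀ᵐ z ∂(volume.restrict Ω), ‖w z‖ ≤ C * ‖w (θ z)‖) :
    WeightedLinfty Ω w →L[ℝ] WeightedLinfty Ω w :=
  (compLinearMap hθ hC).mkContinuous C (norm_compLinearMap_le hθ hC)

theorem toFun_compCLM
    (hθ : Measure.QuasiMeasurePreserving θ (volume.restrict Ω) (volume.restrict Ω))
    (hC : ∀ᵐ z ∂(volume.restrict Ω), ‖w z‖ ≤ C * ‖w (θ z)‖) (φ : WeightedLinfty Ω w) :
    (compCLM hθ hC φ).toFun =ᵐ[volume.restrict Ω] fun z => φ.toFun (θ z) :=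
  toFun_compLinearMap hθ hC φ

theorem norm_compCLM_le
    (hθ : Measure.QuasiMeasurePreserving θ (volume.restrict Ω) (volume.restrict Ω))
    (hC : ∀ᵐ z ∂(volume.restrict Ω), ‖w z‖ ≤ C * ‖w (θ z)‖) :
    ‖compCLM hθ hC‖ ≤ C :=
  LinearMap.mkContinuous_norm_le _ C.2 _

end WeightedLinfty

/-- The preimage of a null set under `Ψ t` is its image under the Lipschitz map `Ψ (-t)`. -/
theorem IsGlobalFlow.quasiMeasurePreserving_restrict {E : Type*} [NormedAddCommGroup E]
    [NormedSpace ℝ E] [FiniteDimensional ℝ E] [MeasurableSpace E] [BorelSpace E]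
    (μ : Measure E) [μ.IsAddHaarMeasure] {F : E → E} {Ψ : ℝ → E → E} {K : ℝ≥0}
    (h : IsGlobalFlow F Ψ) (hF : LipschitzWith K F) {Ω : Set E} {t : ℝ}
    (hmaps : MapsTo (Ψ t) Ω Ω) :
    Measure.QuasiMeasurePreserving (Ψ t) (μ.restrict Ω) (μ.restrict Ω) := by
  have hmeas : Measurable (Ψ t) := (h.lipschitzWith hF t).continuous.measurable
  refine ⟨hmeas, Measure.AbsolutelyContinuous.mk fun N hN h0 => ?_⟩
  rw [Measure.restrict_apply hN] at h0
  rw [Measure.map_apply hmeas hN, Measure.restrict_apply (hmeas hN)]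
  refine measure_mono_null ?_ ((h.lipschitzWith hF (-t)).addHaar_image_eq_zero μ h0)
  exact fun z hz => ⟨Ψ t z, ⟨hz.1, hmaps hz.2⟩, h.neg_apply_apply hF t z⟩

theorem IsGlobalFlow.norm_inv_le {E : Type*} [NormedAddCommGroup E] [NormedSpace ℝ E]
    {F : E → E} {Ψ : ℝ → E → E} {K : ℝ≥0} (h : IsGlobalFlow F Ψ) (hF : LipschitzWith K F)
    (h0 : F 0 = 0) {t C : ℝ} {z : E} (hC : ‖Ψ t z‖ ≤ C * ‖z‖) :
    ‖1 / ‖z‖‖ ≤ C * ‖1 / ‖Ψ t z‖‖ := by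
  rcases eq_or_ne z 0 with rfl | hz
  -- The origin is fixed and `1 / 0 = 0`, so both sides vanish.
  · simp [h.map_zero_of_field hF h0]
  have hΨ : Ψ t z ≠ 0 := fun hzero => hz <| by
    rw [← h.neg_apply_apply hF t z, hzero, h.map_zero_of_field hF h0]
  have h1 : 0 < ‖z‖ := norm_pos_iff.2 hz
  have h2 : 0 < ‖Ψ t z‖ := norm_pos_iff.2 hΨ
  rw [Real.norm_of_nonneg (by positivity), Real.norm_of_nonneg (by positivity), mul_one_div,
    div_le_div_iff₀ h1 h2, one_mul]
  exact hC

end CompositionOperator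

/-! ### Proof of the main theorem -/

theorem mainTheorem8 {d : ℕ} (Ω : Set (EuclideanSpace ℝ (Fin d)))
    (hΩ_open : IsOpen Ω) (hΩ_bdd : Bornology.IsBounded Ω) (hΩ_bdry : HasC1Boundary Ω)
    (f ftilde : EuclideanSpace ℝ (Fin d) → EuclideanSpace ℝ (Fin d))
    (hf : ContDiff ℝ 1 f)
    (A : Matrix (Fin d) (Fin d) ℝ)
    (hdecomp : ∀ x, f x = Matrix.toEuclideanLin A x + ftilde x)
    (hftilde : ftilde =o[𝓝 0] fun x : EuclideanSpace ℝ (Fin d) => x)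
    (hA : ∀ μ : ℂ, Module.End.HasEigenvalue
      (Matrix.toLin' (A.map (algebraMap ℝ ℂ))) μ → μ.re < 0)
    (htan : TangentCondition Ω f)
    (hv_fin : ∀ z ∈ closure Ω, costFunctional f (fun x => ‖x‖₊ ^ 2) z < ∞)
    (hv_sob : MemW1Infty Ω
      (fun z => Real.sqrt (costFunctional f (fun x => ‖x‖₊ ^ 2) z).toReal)) :
    (∀ z ∈ closure Ω, IsForwardSolution f z (fun t => flow f t z) ∧
      ∀ t, 0 ≤ t → flow f t z ∈ closure Ω) ∧
    ∃ S : ℝ≥0 → WeightedLinfty Ω (fun x => 1 / ‖x‖) →L[ℝ] WeightedLinfty Ω (fun x => 1 / ‖x‖),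
      IsCompositionSemigroup Ω (fun x => 1 / ‖x‖) (flow f) S ∧ IsExponentiallyStable S := by
  obtain ⟨R₀, hR₀⟩ := hΩ_bdd.closure.subset_closedBall 0
  -- A positive radius makes the ball a neighborhood of `0`, so `F` has the same linearization there
  -- as `f`, wherever `Ω` lies.
  set R := max R₀ 1
  have hR : closure Ω ⊆ Metric.closedBall 0 R :=
    hR₀.trans (Metric.closedBall_subset_closedBall (le_max_left _ _))
  have hRpos : 0 < R := lt_max_of_lt_right one_pos
  obtain ⟨F, K, C, hF, hC, hFf⟩ := exists_lipschitz_extension hf R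
  obtain ⟨Ψ, hΨ⟩ := exists_isGlobalFlow hF hC
  have hf0 : f 0 = 0 := by
    have : ftilde 0 = 0 := by simpa using (hftilde.def one_pos).self_of_nhds
    rw [hdecomp, this, map_zero, add_zero]
  have hF0 : F 0 = 0 := by rw [hFf 0 (Metric.mem_closedBall_self hRpos.le), hf0]
  have htanF : TangentCondition Ω F := fun x hx n hn => by
    rw [hFf x (hR (frontier_subset_closure hx))]
    exact htan x hx n hn
  have hclosure : ∀ z ∈ closure Ω, ∀ t, 0 ≤ t → Ψ t z ∈ closure Ω := fun z hz t ht =>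
    hΨ.mem_closure hF htanF hΩ_open hΩ_bdry hz ht
  have hsol : ∀ z ∈ closure Ω, IsForwardSolution f z fun t => Ψ t z := fun z hz =>
    ⟨hΨ.map_zero z, fun t ht => by
      rw [← hFf _ (hR (hclosure z hz t ht))]
      exact (hΨ.hasDerivAt z t).hasDerivWithinAt⟩
  have hflow : ∀ z ∈ closure Ω, ∀ t, 0 ≤ t → flow f t z = Ψ t z := fun z hz t ht =>
    (hsol z hz).flow_eq hf ht
  refine ⟨fun z hz => ⟨isForwardSolution_flow (hsol z hz), fun t ht => ?_⟩, ?_⟩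
  · rw [hflow z hz t ht]
    exact hclosure z hz t ht
  have hFA : (fun x => F x - Matrix.toEuclideanLin A x) =o[𝓝 0]
      fun x : EuclideanSpace ℝ (Fin d) => x := by
    refine hftilde.congr' ?_ EventuallyEq.rfl
    filter_upwards [Metric.closedBall_mem_nhds 0 hRpos] with x hx
    rw [hFf x hx, hdecomp, add_sub_cancel_left]
  obtain ⟨δ, T, hδ, hT, hhalf⟩ := hΨ.exists_norm_le_half hF (exists_decaying_solution hA) hFA
  obtain ⟨M₀, ω, hM₀, hω, hloc⟩ := hΨ.exists_local_exponential_bound hF hF0 hT hhalf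
  obtain ⟨M, hM, hbound⟩ := hΨ.exists_exponential_bound hF hF0 hΩ_bdd.isCompact_closure hM₀ hω hloc
    fun z hz => by
      obtain ⟨t, ht, h1⟩ := exists_norm_flow_lt_of_costFunctional_lt_top (hv_fin z hz) hδ
      rw [hflow z hz t ht.le] at h1
      exact ⟨t, ht.le, h1⟩
  let D : ℝ≥0 → ℝ≥0 := fun t => ⟨M * Real.exp (-ω * t), by positivity⟩
  have hq : ∀ t : ℝ≥0, Measure.QuasiMeasurePreserving (Ψ t) (volume.restrict Ω)
      (volume.restrict Ω) := fun t =>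
    hΨ.quasiMeasurePreserving_restrict volume hF
      fun z hz => hΨ.mem_of_mem hF htanF hΩ_open hΩ_bdry hz t.2
  have hD : ∀ t : ℝ≥0, ∀ᵐ z ∂(volume.restrict Ω),
      ‖1 / ‖z‖‖ ≤ D t * ‖1 / ‖Ψ t z‖‖ := fun t => by
    filter_upwards [ae_restrict_mem hΩ_open.measurableSet] with z hz
    exact hΨ.norm_inv_le hF hF0 (hbound z (subset_closure hz) t t.2)
  -- The operators are built from `Ψ`, which is measurable and invertible on the whole space; `flow
  -- f` agrees with it only on the closure of `Ω`, which suffices almost everywhere.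
  let S : ℝ≥0 → WeightedLinfty Ω (fun x => 1 / ‖x‖) →L[ℝ] WeightedLinfty Ω (fun x => 1 / ‖x‖) :=
    fun t => WeightedLinfty.compCLM (hq t) (hD t)
  have hS : ∀ t φ, (S t φ).toFun =ᵐ[volume.restrict Ω] fun z => φ.toFun (Ψ t z) := fun t φ =>
    WeightedLinfty.toFun_compCLM (hq t) (hD t) φ
  refine ⟨S, ⟨fun t φ g hg => ?_, ?_, fun s t => ?_⟩, M, ω, hω, fun t =>
    WeightedLinfty.norm_compCLM_le (hq t) (hD t)⟩
  · filter_upwards [hS t φ, (hq t).ae_eq_comp hg, ae_restrict_mem hΩ_open.measurableSet]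
      with z h1 h2 hz
    rw [h1, hflow z (subset_closure hz) t t.2]
    exact h2.symm
  · ext φ
    apply WeightedLinfty.ext_of_ae
    filter_upwards [hS 0 φ] with z h1
    rw [h1, NNReal.coe_zero, hΨ.map_zero]
    rfl
  · ext φ
    apply WeightedLinfty.ext_of_ae
    -- Composition reverses the order: `S s (S t φ)` is `φ ∘ Ψ t ∘ Ψ s`, hence the `add_comm`.
    filter_upwards [hS (s + t) φ, hS s (S t φ), (hq s).ae_eq_comp (hS t φ)] with z h1 h2 h3
    rw [ContinuousLinearMap.comp_apply, h1, h2, NNReal.coe_add, add_comm, hΨ.map_add hF]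
    exact h3.symm
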